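/- Let $M$ be a paving matroid of rank $k$ on a finite ground set $E$ with $|E|=n$ and $2\le k\le n-1$; paving means that every circuit of $M$ has size $k$ or $k+1$. For an integer $r\ge 0$, let $\mathcal E^{r}(M)$ be the elongation of $M$ by rank $r$, that is, the matroid on $E$ whose independent sets are the sets $A\subseteq E$ with $|A|-\mathrm{rk}_M(A)\le r$. For $1\le r\le n-k$, let the $r$-th generalized Hamming weight $d_r(M)$ be the minimum size of a circuit of $\mathcal E^{r-1}(M)$. Let $\mathbb L$ be any field, $S=\mathbb L[x_e : e\in E]$ with the standard grading, and let $I_{\Delta(M)}\subseteq S$ be the Stanley--Reisner ideal of the independence complex $\Delta(M)$ of $M$, i.e. the ideal generated by the monomials $x^U=\prod_{e\in U}x_e$ with $U\subseteq E$ dependent in $M$. For an ideal $I\subseteq S$ let $I^{(s)}=\bigcap_{P\in\mathrm{Ass}(S/I)}(I^sS_P\cap S)$ denote its $s$-th symbolic power, and for a nonzero homogeneous ideal $I$ let $\alpha(I)$ denote the smallest degree of a nonzero homogeneous element of $I$. Then the sequence $\{d_r(M)\}_{r=1}^{n-k}$ is subadditive, i.e. $d_{i+j}(M)\le d_i(M)+d_j(M)$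 for all $i,j\ge 1$ with $i+j\le n-k$. In particular, $$\alpha\bigl(I_{\Delta(M)}^{(r)}\bigr)=d_r(M)\qquad\text{for all } 1\le r\le n-k.$$ -/

import Mathlib

namespace Matroid

variable {α : Type*}

/-- The elongation `𝓔 ^ r (M)` of a matroid `M` on a finite ground set by rank `r`: the matroid on
the same ground set whose independent sets are the sets `A` with nullity `|A| - rk_M A ≤ r`. -/
noncomputable def elongation (M : Matroid α) [M.Finite] (r : ℕ) : Matroid α :=
  (IndepMatroid.ofFinite (E := M.E) M.ground_finite
    (fun A => A ⊆ M.E ∧ A.encard ≤ M.eRk A + r)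
    (by simp)
    (by
      rintro I J ⟨hJ, hJr⟩ hIJ
      refine ⟨hIJ.trans hJ, ?_⟩
      have h1 := M.eRk_le_eRk_add_eRk_sdiff hIJ
      have h2 := M.eRk_le_encard (J \ I)
      have h3 := Set.encard_sdiff_add_encard_of_subset hIJ
      have hfin : (J \ I).encard ≠ ⊤ :=
        (M.ground_finite.subset (Set.sdiff_subset.trans hJ)).encard_lt_top.ne
      have h4 : (J \ I).encard + I.encard ≤ (J \ I).encard + (M.eRk I + r) := by
        rw [h3]
        calc J.encard ≤ M.eRk J + r := hJr
          _ ≤ (M.eRk I + (J \ I).encard) + r := by gcongr; exact h1.trans (by gcongr)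
          _ = _ := by ring
      exact (ENat.add_le_add_iff_left hfin).1 h4)
    (by
      rintro I J ⟨hI, hIr⟩ ⟨hJ, hJr⟩ hlt
      have hIf := M.ground_finite.subset hI
      have hJf := M.ground_finite.subset hJ
      have hlt' : I.encard < J.encard := by
        rw [← hIf.cast_ncard_eq, ← hJf.cast_ncard_eq]; exact_mod_cast hlt
      rcases hIr.lt_or_eq with h | h
      · obtain ⟨e, heJ, heI⟩ := Set.exists_mem_notMem_of_ncard_lt_ncard hlt hIf
        refine ⟨e, heJ, heI, Set.insert_subset (hJ heJ) hI, ?_⟩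
        rw [Set.encard_insert_of_notMem heI]
        exact (Order.add_one_le_of_lt h).trans (by gcongr; exact M.eRk_mono (Set.subset_insert _ _))
      · have hr : M.eRk I < M.eRk J := by
          have h5 : M.eRk I + r < M.eRk J + r := by rw [← h]; exact hlt'.trans_le hJr
          exact lt_of_add_lt_add_right h5
        obtain ⟨e, he, heq⟩ := M.exists_eRk_insert_eq_add_one_of_lt hr
        refine ⟨e, he.1, he.2, Set.insert_subset (hJ he.1) hI, ?_⟩
        rw [Set.encard_insert_of_notMem he.2, heq, h]
        exact (by ring : M.eRk I + r + 1 = M.eRk I + 1 + r).le)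
    (fun _ h => h.1)).matroid

@[simp] theorem elongation_ground (M : Matroid α) [M.Finite] (r : ℕ) :
    (M.elongation r).E = M.E := rfl

@[simp] theorem elongation_indep_iff (M : Matroid α) [M.Finite] (r : ℕ) (A : Set α) :
    (M.elongation r).Indep A ↔ A ⊆ M.E ∧ A.encard ≤ M.eRk A + r := Iff.rfl

/-- The `r`-th generalized Hamming weight `d_r(M)`, for `1 ≤ r ≤ rk (M✶)`: the minimum size of a
circuit of the elongation of `M` by rank `r - 1`. -/
noncomputable def genHammingWeight (M : Matroid α) [M.Finite] (r : ℕ) : ℕ :=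
  sInf {d : ℕ | ∃ C : Set α, (M.elongation (r - 1)).IsCircuit C ∧ C.ncard = d}

/-- In the range `1 ≤ r ≤ |E| - rk M`, the infimum defining `d_r(M)` is a genuine minimum. -/
theorem isLeast_genHammingWeight (M : Matroid α) [M.Finite] (r : ℕ) (hr : 1 ≤ r)
    (hrM : M.eRank + r ≤ M.E.encard) :
    IsLeast {d : ℕ | ∃ C : Set α, (M.elongation (r - 1)).IsCircuit C ∧ C.ncard = d}
      (M.genHammingWeight r) := by
  have hdep : (M.elongation (r - 1)).Dep M.E := by
    refine ⟨?_, subset_rfl⟩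
    rw [elongation_indep_iff, not_and, not_le, eRk_ground]
    intro _
    refine lt_of_lt_of_le ?_ hrM
    have htop : M.eRank ≠ ⊤ :=
      ((M.eRank_le_encard_ground).trans_lt M.ground_finite.encard_lt_top).ne
    exact (ENat.add_lt_add_iff_left htop).2 (by exact_mod_cast (by omega : r - 1 < r))
  obtain ⟨C, -, hC⟩ := hdep.exists_isCircuit_subset
  have hne : {d : ℕ | ∃ C : Set α, (M.elongation (r - 1)).IsCircuit C ∧ C.ncard = d}.Nonempty :=
    ⟨_, C, hC, rfl⟩
  exact ⟨Nat.sInf_mem hne, fun _ h => Nat.sInf_le h⟩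

/-- A matroid is paving if every circuit has size equal to the rank or to the rank plus one. -/
def IsPaving (M : Matroid α) : Prop :=
  ∀ C : Set α, M.IsCircuit C → C.encard = M.eRank ∨ C.encard = M.eRank + 1

/-- The independence complex `Δ(M)`, on the vertex set `M.E`: its faces are the independent sets.
(The empty face is left implicit, as everywhere for `PreAbstractSimplicialComplex`.) -/
def independenceComplex (M : Matroid α) : PreAbstractSimplicialComplex M.E where
  faces := {s | s.Nonempty ∧ M.Indep (Subtype.val '' (s : Set M.E))}
  isRelLowerSet_faces := by
    rintro s ⟨hs, hi⟩
    exact ⟨hs, fun t hts ht => ⟨ht, hi.subset (Set.image_mono (by exact_mod_cast hts))⟩⟩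

end Matroid

/-- The Stanley-Reisner ideal, in the polynomial ring over `L` with one variable per vertex, of a
simplicial complex: it is generated by the squarefree monomials `x ^ U = ∏ u ∈ U, x_u` of the
non-faces `U`. -/
noncomputable def stanleyReisnerIdeal (L : Type*) [Field L] {σ : Type*}
    (K : PreAbstractSimplicialComplex σ) : Ideal (MvPolynomial σ L) :=
  Ideal.span {f | ∃ U : Finset σ, U.Nonempty ∧ U ∉ K ∧ f = ∏ u ∈ U, MvPolynomial.X u}

/-- The `s`-th symbolic power of an ideal: the intersection, over the associated primes `P` of
`R ⧸ I`, of the contractions to `R` of `I ^ s R_P`. -/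
noncomputable def symbolicPower {R : Type*} [CommRing R] (I : Ideal R) (s : ℕ) : Ideal R :=
  ⨅ (P : Ideal R) (hP : P ∈ associatedPrimes R (R ⧸ I)),
    haveI : P.IsPrime := hP.isPrime
    ((I ^ s).map (algebraMap R (Localization.AtPrime P))).comap
      (algebraMap R (Localization.AtPrime P))

/-- The initial degree `α(I)` of a nonzero homogeneous ideal of a polynomial ring with the standard
grading: the smallest `d` such that `I` has a nonzero element that is homogeneous of degree `d`. -/
noncomputable def initialDegree {L σ : Type*} [Field L] (I : Ideal (MvPolynomial σ L)) : ℕ :=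
  sInf {d : ℕ | ∃ f ∈ I, f ≠ 0 ∧ f.IsHomogeneous d}

/-- A finite sequence `a 1, …, a N` of real numbers is subadditive if `a (i + j) ≤ a i + a j`
whenever `i, j ≥ 1` and `i + j ≤ N`. -/
def IsSubadditiveUpTo (a : ℕ → ℝ) (N : ℕ) : Prop :=
  ∀ i j : ℕ, 1 ≤ i → 1 ≤ j → i + j ≤ N → a (i + j) ≤ a i + a j

/-! ### Symbolic powers and weighted orders of polynomials. -/

section Algebra

open MvPolynomial

variable {σ L : Type*} [Field L]

/-! The weight `d_r` is the least size of a set of nullity at least `r`. In a paving matroid every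
set with fewer than `k` elements is independent, which pins `d_r` to `k + r - 1` or `k + r`
(`genHammingWeight_le`, `IsPaving.le_genHammingWeight_add_one`). As `k ≥ 2`, subadditivity follows.

For the symbolic power, each base `B` gives an associated prime, generated by the variables off `B`.
Monomials in `I^(r)` thus have weight at least `r` off every base; conversely, a squarefree monomial
with this property lies in `I^(r)`. A set of nullity at least `r` is exactly one with at least `r`
elements off every base, so `α ≤ d_r`, and squarefree monomials cannot do better. A monomial with a
repeated variable has weight at least `k` on some base, hence degree at least `k + r ≥ d_r`
(`IsPaving.genHammingWeight_le_degree`). -/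

theorem mem_symbolicPower {R : Type*} [CommRing R] {I : Ideal R} {s : ℕ} {f : R} :
    f ∈ symbolicPower I s ↔
      ∀ P ∈ associatedPrimes R (R ⧸ I), ∃ t, t ∉ P ∧ t * f ∈ I ^ s := by
  simp only [symbolicPower, Submodule.mem_iInf]
  refine forall₂_congr fun P hP => ?_
  have : P.IsPrime := hP.isPrime
  rw [Ideal.mem_comap,
    IsLocalization.algebraMap_mem_map_algebraMap_iff P.primeCompl (Localization.AtPrime P)]
  rfl

theorem smul_quotientMk {R : Type*} [CommRing R] (I : Ideal R) (p g : R) :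
    p • Ideal.Quotient.mk I g = Ideal.Quotient.mk I (p * g) :=
  rfl

/-- The ideal of the polynomials all of whose monomials have weight at least `r`. -/
noncomputable def weightIdeal (L : Type*) [Field L] (w : σ → ℕ) (r : ℕ) :
    Ideal (MvPolynomial σ L) where
  carrier := {f | (r : ℕ∞) ≤ (f : MvPowerSeries σ L).weightedOrder w}
  zero_mem' := by simp
  add_mem' {f g} hf hg := by
    simp only [Set.mem_ofPred_eq, coe_add] at *
    exact (le_min hf hg).trans (MvPowerSeries.min_weightedOrder_le_add w)
  smul_mem' c f hf := by
    simp only [Set.mem_ofPred_eq, smul_eq_mul, coe_mul, MvPowerSeries.weightedOrder_mul] at *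
    exact le_add_left hf

theorem mem_weightIdeal_iff_weightedOrder {w : σ → ℕ} {r : ℕ} {f : MvPolynomial σ L} :
    f ∈ weightIdeal L w r ↔ (r : ℕ∞) ≤ (f : MvPowerSeries σ L).weightedOrder w :=
  Iff.rfl

theorem mem_weightIdeal {w : σ → ℕ} {r : ℕ} {f : MvPolynomial σ L} :
    f ∈ weightIdeal L w r ↔ ∀ m ∈ f.support, r ≤ Finsupp.weight w m := by
  rw [mem_weightIdeal_iff_weightedOrder]
  constructor
  · intro h m hm
    have := h.trans (MvPowerSeries.weightedOrder_le w (d := m) (by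
      rwa [coeff_coe, ← mem_support_iff]))
    exact_mod_cast this
  · intro h
    refine MvPowerSeries.nat_le_weightedOrder w fun d hd => ?_
    rw [coeff_coe, ← notMem_support_iff]
    exact fun hd' => hd.not_ge (h d hd')

theorem pow_weightIdeal_le (w : σ → ℕ) (r : ℕ) :
    weightIdeal L w 1 ^ r ≤ weightIdeal L w r := by
  induction r with
  | zero => intro f _; simp [mem_weightIdeal]
  | succ r ih =>
    rw [pow_succ, Ideal.mul_le]
    intro f hf g hg
    have hf := ih hf
    rw [mem_weightIdeal_iff_weightedOrder] at *
    rw [coe_mul, MvPowerSeries.weightedOrder_mul]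
    push_cast at *
    exact add_le_add hf hg

theorem isPrime_weightIdeal_one (w : σ → ℕ) : (weightIdeal L w 1).IsPrime := by
  refine ⟨?_, ?_⟩
  · rw [Ideal.ne_top_iff_one, mem_weightIdeal]
    simp [support_one]
  · intro f g hfg
    simp only [mem_weightIdeal_iff_weightedOrder, coe_mul, MvPowerSeries.weightedOrder_mul,
      Nat.cast_one, Order.one_le_iff_pos] at *
    exact add_pos_iff.1 hfg

/-- Weighted orders add under multiplication and `g` has order zero. This clears the denominators of
the localization. -/
theorem mem_weightIdeal_of_mul_mem {w : σ → ℕ} {r : ℕ} {f g : MvPolynomial σ L}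
    (hg : g ∉ weightIdeal L w 1) (h : g * f ∈ weightIdeal L w r) : f ∈ weightIdeal L w r := by
  simp only [mem_weightIdeal_iff_weightedOrder, coe_mul, MvPowerSeries.weightedOrder_mul,
    Nat.cast_one, Order.one_le_iff_pos, not_lt, nonpos_iff_eq_zero] at *
  rwa [hg, zero_add] at h

open Classical in
/-- The weight of a variable outside `B` is one, that of a variable in `B` is zero. -/
noncomputable def complWeight (B : Finset σ) (e : σ) : ℕ := if e ∈ B then 0 else 1

theorem prod_X_mem_weightIdeal_iff {w : σ → ℕ} {r : ℕ} {U : Finset σ} :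
    (∏ u ∈ U, X u : MvPolynomial σ L) ∈ weightIdeal L w r ↔ r ≤ ∑ u ∈ U, w u := by
  classical
  have : (∏ u ∈ U, X u : MvPolynomial σ L) = monomial (∑ u ∈ U, Finsupp.single u 1) 1 := by
    rw [monomial_sum_one]; rfl
  rw [this, mem_weightIdeal, support_monomial, if_neg one_ne_zero]
  simp [Finsupp.weight_single]

theorem prod_X_mem_weightIdeal_complWeight_iff {B U : Finset σ} :
    (∏ u ∈ U, X u : MvPolynomial σ L) ∈ weightIdeal L (complWeight B) 1 ↔ ¬ U ⊆ B := by
  rw [prod_X_mem_weightIdeal_iff, Nat.one_le_iff_ne_zero, Ne, Finset.sum_eq_zero_iff]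
  simp [complWeight, Finset.subset_iff]

/-! ### Stanley-Reisner ideals and the primes of their facets. -/

variable {K : PreAbstractSimplicialComplex σ} {F : Set (Finset σ)}

/-- In `hF`, the family `F` plays the facets; the disjunct `U = ∅` restores the implicit empty face.
-/
theorem prod_X_mem_stanleyReisnerIdeal (hF : ∀ U, U = ∅ ∨ U ∈ K ↔ ∃ B ∈ F, U ⊆ B)
    {U : Finset σ} (hU : ∀ B ∈ F, ¬ U ⊆ B) :
    (∏ u ∈ U, X u : MvPolynomial σ L) ∈ stanleyReisnerIdeal L K := by
  have h : ¬ (U = ∅ ∨ U ∈ K) := by rw [hF]; push Not; exact hU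
  push Not at h
  exact Ideal.subset_span ⟨U, h.1, h.2, rfl⟩

theorem stanleyReisnerIdeal_le_weightIdeal (hF : ∀ U, U = ∅ ∨ U ∈ K ↔ ∃ B ∈ F, U ⊆ B)
    {B : Finset σ} (hB : B ∈ F) :
    stanleyReisnerIdeal L K ≤ weightIdeal L (complWeight B) 1 := by
  refine Ideal.span_le.2 ?_
  rintro _ ⟨U, hU, hUK, rfl⟩
  refine prod_X_mem_weightIdeal_complWeight_iff.2 fun hUB => ?_
  rcases (hF U).2 ⟨B, hB, hUB⟩ with h | h
  · exact hU.ne_empty h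
  · exact hUK h

/-- The Stanley-Reisner ideal is the intersection of the primes belonging to the facets. -/
theorem mem_stanleyReisnerIdeal_iff (hF : ∀ U, U = ∅ ∨ U ∈ K ↔ ∃ B ∈ F, U ⊆ B)
    {g : MvPolynomial σ L} :
    g ∈ stanleyReisnerIdeal L K ↔ ∀ B ∈ F, g ∈ weightIdeal L (complWeight B) 1 := by
  refine ⟨fun h B hB => stanleyReisnerIdeal_le_weightIdeal hF hB h, fun h => ?_⟩
  rw [g.as_sum]
  refine Ideal.sum_mem _ fun m hm => ?_
  have hdvd : (∏ u ∈ m.support, X u : MvPolynomial σ L) ∣ monomial m (coeff m g) := by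
    rw [monomial_eq]
    refine Dvd.dvd.mul_left (Finset.prod_dvd_prod_of_dvd _ _ fun u hu => ?_) _
    exact dvd_pow_self _ (Finsupp.mem_support_iff.1 hu)
  refine Ideal.mem_of_dvd _ hdvd (prod_X_mem_stanleyReisnerIdeal hF fun B hB hmB => ?_)
  have := mem_weightIdeal.1 (h B hB) m hm
  rw [Finsupp.weight_apply, Finsupp.sum, Finset.sum_eq_zero] at this
  · omega
  · intro u hu
    simp [complWeight, hmB hu]

/-- The prime of `B` is the annihilator of the class of `x^B`: by the antichain condition `x^B` lies
in the prime of every other facet, but not in that of `B`. -/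
theorem weightIdeal_mem_associatedPrimes (hF : ∀ U, U = ∅ ∨ U ∈ K ↔ ∃ B ∈ F, U ⊆ B)
    (hanti : IsAntichain (· ⊆ ·) F) {B : Finset σ} (hB : B ∈ F) :
    weightIdeal L (complWeight B) 1 ∈
      associatedPrimes (MvPolynomial σ L) (MvPolynomial σ L ⧸ stanleyReisnerIdeal L K) := by
  have hprime := isPrime_weightIdeal_one (L := L) (complWeight B)
  refine ⟨hprime, Ideal.Quotient.mk _ (∏ u ∈ B, X u), ?_⟩
  -- Associated primes are defined by radicals of colon ideals; here the colon ideal is already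
  -- prime.
  rw [← hprime.radical]
  congr 1
  ext g
  have hBB : (∏ u ∈ B, X u : MvPolynomial σ L) ∉ weightIdeal L (complWeight B) 1 := by
    simp [prod_X_mem_weightIdeal_complWeight_iff]
  rw [Submodule.mem_colon_singleton, Submodule.mem_bot, smul_quotientMk,
    Ideal.Quotient.eq_zero_iff_mem, mem_stanleyReisnerIdeal_iff hF]
  constructor
  · intro hg B' hB'
    by_cases h : B = B'
    · exact h ▸ Ideal.mul_mem_right _ _ hg
    · exact Ideal.mul_mem_left _ _
        (prod_X_mem_weightIdeal_complWeight_iff.2 (hanti hB hB' h))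
  · intro h
    exact (hprime.mem_or_mem (h B hB)).resolve_right hBB

/-- This avoids classifying the associated primes. If `P` comes from `g`, some facet prime misses
`g`; were `x^B` in `P`, a power of it times `g` would lie in that prime, forcing `x^B` into it. -/
theorem exists_prod_X_notMem_of_mem_associatedPrimes
    (hF : ∀ U, U = ∅ ∨ U ∈ K ↔ ∃ B ∈ F, U ⊆ B) {P : Ideal (MvPolynomial σ L)}
    (hP : P ∈ associatedPrimes (MvPolynomial σ L)
      (MvPolynomial σ L ⧸ stanleyReisnerIdeal L K)) :
    ∃ B ∈ F, (∏ u ∈ B, X u : MvPolynomial σ L) ∉ P := by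
  obtain ⟨hprime, x, hx⟩ := hP
  obtain ⟨g, rfl⟩ := Ideal.Quotient.mk_surjective x
  have hmem (p : MvPolynomial σ L) : p ∈ P ↔ ∃ n : ℕ, p ^ n * g ∈ stanleyReisnerIdeal L K := by
    rw [hx, Ideal.mem_radical_iff]
    refine exists_congr fun n => ?_
    rw [Submodule.mem_colon_singleton, Submodule.mem_bot, smul_quotientMk,
      Ideal.Quotient.eq_zero_iff_mem]
  have hg : g ∉ stanleyReisnerIdeal L K := fun h =>
    hprime.ne_top ((Ideal.eq_top_iff_one _).2 ((hmem 1).2 ⟨0, by simpa using h⟩))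
  rw [mem_stanleyReisnerIdeal_iff hF] at hg
  push Not at hg
  obtain ⟨B, hB, hgB⟩ := hg
  refine ⟨B, hB, fun h => ?_⟩
  obtain ⟨n, hn⟩ := (hmem _).1 h
  have hprime' := isPrime_weightIdeal_one (L := L) (complWeight B)
  have := (hprime'.mem_or_mem (stanleyReisnerIdeal_le_weightIdeal hF hB hn)).resolve_right hgB
  exact prod_X_mem_weightIdeal_complWeight_iff.1 (hprime'.mem_of_pow_mem _ this) subset_rfl

/-- The symbolic power of a Stanley-Reisner ideal is contained in the powers of the primes belonging
to the facets. -/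
theorem symbolicPower_stanleyReisnerIdeal_le (hF : ∀ U, U = ∅ ∨ U ∈ K ↔ ∃ B ∈ F, U ⊆ B)
    (hanti : IsAntichain (· ⊆ ·) F) {B : Finset σ} (hB : B ∈ F) (r : ℕ) :
    symbolicPower (stanleyReisnerIdeal L K) r ≤ weightIdeal L (complWeight B) r := by
  intro f hf
  obtain ⟨t, ht, htf⟩ := mem_symbolicPower.1 hf _ (weightIdeal_mem_associatedPrimes hF hanti hB)
  exact mem_weightIdeal_of_mul_mem ht
    (pow_weightIdeal_le _ _ (Ideal.pow_right_mono (stanleyReisnerIdeal_le_weightIdeal hF hB) r htf))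

theorem prod_X_mem_symbolicPower [DecidableEq σ] (hF : ∀ U, U = ∅ ∨ U ∈ K ↔ ∃ B ∈ F, U ⊆ B)
    (hanti : IsAntichain (· ⊆ ·) F) {U : Finset σ} {r : ℕ}
    (hU : ∀ B ∈ F, r ≤ (U \ B).card) :
    (∏ u ∈ U, X u : MvPolynomial σ L) ∈ symbolicPower (stanleyReisnerIdeal L K) r := by
  refine mem_symbolicPower.2 fun P hP => ?_
  obtain ⟨B, hB, hBP⟩ := exists_prod_X_notMem_of_mem_associatedPrimes hF hP
  obtain ⟨V, hVU, rfl⟩ := Finset.exists_subset_card_eq (hU B hB)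
  -- Each of the `r` elements `v` of `V` absorbs one copy of `x^B`; since `B` is a facet, `B ∪ {v}`
  -- is a nonface.
  refine ⟨(∏ u ∈ B, X u) ^ V.card, fun h => hBP (hP.isPrime.mem_of_pow_mem _ h), ?_⟩
  rw [← Finset.prod_sdiff (hVU.trans Finset.sdiff_subset), mul_left_comm,
    Finset.pow_card_mul_prod]
  refine Ideal.mul_mem_left _ _ ?_
  rw [← Finset.prod_const]
  refine Ideal.prod_mem_prod fun v hv => ?_
  have hvB : v ∉ B := (Finset.mem_sdiff.1 (hVU hv)).2
  rw [mul_comm, ← Finset.prod_insert hvB]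
  refine prod_X_mem_stanleyReisnerIdeal hF fun B' hB' h => hvB ?_
  rw [hanti.eq hB hB' ((Finset.subset_insert v B).trans h)]
  exact h (Finset.mem_insert_self v B)

end Algebra

/-! ### Nullity and Hamming weights of paving matroids. -/

namespace Matroid

variable {α : Type*} {M : Matroid α} {r k : ℕ}

theorem exists_ncard_eq_genHammingWeight (M : Matroid α) [M.Finite] (hr : 1 ≤ r)
    (hrM : M.eRank + r ≤ M.E.encard) :
    ∃ C ⊆ M.E, M.eRk C + r ≤ C.encard ∧ C.ncard = M.genHammingWeight r := by
  obtain ⟨C, hC, hcard⟩ := (M.isLeast_genHammingWeight r hr hrM).1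
  have hCE : C ⊆ M.E := hC.subset_ground
  refine ⟨C, hCE, ?_, hcard⟩
  have h := hC.dep.not_indep
  rw [elongation_indep_iff, not_and, not_le] at h
  have h2 := Order.add_one_le_of_lt (h hCE)
  obtain ⟨s, rfl⟩ : ∃ s, r = s + 1 := ⟨r - 1, by omega⟩
  simpa [add_assoc] using h2

theorem genHammingWeight_le_ncard [M.Finite] (hr : 1 ≤ r) {A : Set α} (hA : A ⊆ M.E)
    (hAr : M.eRk A + r ≤ A.encard) : M.genHammingWeight r ≤ A.ncard := by
  have hAfin := M.ground_finite.subset hA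
  have hdep : (M.elongation (r - 1)).Dep A := by
    refine ⟨fun h => ?_, hA⟩
    have h1 := hAr.trans ((elongation_indep_iff _ _ _).1 h).2
    have htop : M.eRk A ≠ ⊤ := ((M.eRk_le_encard A).trans_lt hAfin.encard_lt_top).ne
    have h2 := (ENat.add_le_add_iff_left htop).1 h1
    have h3 : r ≤ r - 1 := by exact_mod_cast h2
    omega
  obtain ⟨C, hCA, hC⟩ := hdep.exists_isCircuit_subset
  exact (Nat.sInf_le ⟨C, hC, rfl⟩ : M.genHammingWeight r ≤ C.ncard).trans
    (Set.ncard_le_ncard hCA hAfin)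

/-- In a paving matroid of rank `k`, every set of size less than `k` is independent. -/
theorem IsPaving.indep_of_encard_lt (hM : M.IsPaving) {A : Set α} (hA : A ⊆ M.E)
    (h : A.encard < M.eRank) : M.Indep A := by
  by_contra hi
  obtain ⟨C, hCA, hC⟩ := Dep.exists_isCircuit_subset (⟨hi, hA⟩ : M.Dep A)
  have h1 := (Set.encard_le_encard hCA).trans_lt h
  rcases hM C hC with h2 | h2
  · exact h1.ne h2
  · rw [h2] at h1
    exact h1.not_ge le_self_add

theorem genHammingWeight_le [M.Finite] (hk : M.eRank = k) (hr : 1 ≤ r)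
    (hrM : M.eRank + r ≤ M.E.encard) : M.genHammingWeight r ≤ k + r := by
  obtain ⟨A, hAE, hA⟩ := Set.exists_subset_encard_eq hrM
  have h : A.encard = (k + r : ℕ) := by rw [hA, hk]; push_cast; rfl
  refine (genHammingWeight_le_ncard hr hAE ?_).trans ?_
  · rw [hA]; gcongr; exact M.eRk_le_eRank A
  · rw [Set.ncard, h, ENat.toNat_natCast]

theorem IsPaving.le_genHammingWeight_add_one [M.Finite] (hM : M.IsPaving) (hk : M.eRank = k)
    (hr : 1 ≤ r) (hrM : M.eRank + r ≤ M.E.encard) : k + r ≤ M.genHammingWeight r + 1 := by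
  obtain ⟨C, hCE, hC, hcard⟩ := M.exists_ncard_eq_genHammingWeight hr hrM
  have hCfin := M.ground_finite.subset hCE
  rw [← hcard]
  by_contra! hlt
  obtain ⟨q, hq⟩ : ∃ q : ℕ, (q : ℕ∞) = M.eRk C :=
    ENat.ne_top_iff_exists.1 ((M.eRk_le_encard C).trans_lt hCfin.encard_lt_top).ne
  rw [← hq, ← hCfin.cast_ncard_eq] at hC
  have hC' : q + r ≤ C.ncard := by exact_mod_cast hC
  rcases lt_or_ge C.ncard k with h | h
  · have hi := hM.indep_of_encard_lt hCE (by
      rw [hk, ← hCfin.cast_ncard_eq]; exact_mod_cast h)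
    rw [hi.eRk_eq_encard, ← hCfin.cast_ncard_eq] at hq
    have : q = C.ncard := by exact_mod_cast hq
    omega
  -- An independent `(k - 1)`-subset forces rank at least `k - 1`, while the assumed size and
  -- nullity allow at most `k - 2`.
  · obtain ⟨D, hDC, hD⟩ := Set.exists_subset_card_eq (s := C) (n := k - 1) (by omega)
    have hDfin := hCfin.subset hDC
    rcases Nat.eq_zero_or_pos k with rfl | hkpos
    · omega
    have hi := hM.indep_of_encard_lt (hDC.trans hCE) (by
      rw [hk, ← hDfin.cast_ncard_eq, hD]; exact_mod_cast (by omega : k - 1 < k))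
    have h2 := M.eRk_mono hDC
    rw [hi.eRk_eq_encard, ← hq, ← hDfin.cast_ncard_eq, hD] at h2
    have : k - 1 ≤ q := by exact_mod_cast h2
    omega

/-- A set with at least `r` elements outside every base has nullity at least `r`. -/
theorem eRk_add_le_encard_of_forall_isBase {A : Set α} (hA : A ⊆ M.E)
    (h : ∀ B, M.IsBase B → (r : ℕ∞) ≤ (A \ B).encard) : M.eRk A + r ≤ A.encard := by
  obtain ⟨I, hI⟩ := M.exists_isBasis A
  obtain ⟨B, hB, hIB⟩ := hI.indep.exists_isBase_superset
  rw [← hI.encard_eq_eRk, ← Set.encard_sdiff_add_encard_of_subset hI.subset, add_comm]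
  gcongr
  exact (h B hB).trans (Set.encard_le_encard (Set.sdiff_subset_sdiff_right hIB))

/-- A set of nullity at least `r` has at least `r` elements outside every base. -/
theorem IsBase.le_encard_sdiff {A B : Set α} [M.Finite] (hB : M.IsBase B) (hA : A ⊆ M.E)
    (h : M.eRk A + r ≤ A.encard) : (r : ℕ∞) ≤ (A \ B).encard := by
  have h1 : (A ∩ B).encard ≤ M.eRk A := by
    rw [← (hB.indep.subset Set.inter_subset_right).eRk_eq_encard]
    exact M.eRk_mono Set.inter_subset_left
  have htop : M.eRk A ≠ ⊤ :=
    ((M.eRk_le_encard A).trans_lt (M.ground_finite.subset hA).encard_lt_top).ne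
  refine (ENat.add_le_add_iff_left htop).1 (h.trans ?_)
  rw [← Set.encard_sdiff_add_encard_inter A B, add_comm]
  gcongr

/-- The vectors `a` with total weight at least `r` off every base of a paving matroid have degree at
least `d_r`. -/
theorem IsPaving.genHammingWeight_le_degree [M.Finite] (hM : M.IsPaving) (hk : M.eRank = k)
    (hk2 : 2 ≤ k) (hr : 1 ≤ r) (hrM : M.eRank + r ≤ M.E.encard) (a : M.E →₀ ℕ)
    (ha : ∀ B : Finset M.E, M.IsBase (Subtype.val '' (B : Set M.E)) →
      r ≤ Finsupp.weight (complWeight B) a) :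
    M.genHammingWeight r ≤ a.degree := by
  classical
  have hfin : Fintype M.E := M.ground_finite.fintype
  have hext (I : Finset M.E) (hI : M.Indep (Subtype.val '' (I : Set M.E))) :
      ∃ B : Finset M.E, I ⊆ B ∧ M.IsBase (Subtype.val '' (B : Set M.E)) := by
    obtain ⟨B, hB, hIB⟩ := hI.exists_isBase_superset
    refine ⟨(Subtype.val ⁻¹' B : Set M.E).toFinset, ?_, ?_⟩
    · intro x hx
      simpa using hIB ⟨x, by simpa using hx, rfl⟩
    · rw [Set.coe_toFinset, Subtype.image_preimage_coe, Set.inter_eq_right.2 hB.subset_ground]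
      exact hB
  have hsub (I : Finset M.E) : Subtype.val '' (I : Set M.E) ⊆ M.E :=
    Subtype.coe_image_subset _ _
  have henc (I : Finset M.E) : (Subtype.val '' (I : Set M.E)).encard = I.card := by
    rw [Subtype.val_injective.encard_image, Set.encard_coe_eq_coe_finsetCard]
  have hsmall (I : Finset M.E) (hI : I.card < k) : M.Indep (Subtype.val '' (I : Set M.E)) :=
    hM.indep_of_encard_lt (hsub I) (by rw [henc, hk]; exact_mod_cast hI)
  have hw (B : Finset M.E) :
      Finsupp.weight (complWeight B) a + ∑ e ∈ B, a e = a.degree := by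
    rw [Finsupp.weight_eq_sum, Finsupp.degree_eq_sum, ← Finset.sum_filter_add_sum_filter_not
      Finset.univ (· ∈ B) a, add_comm]
    congr 1
    · simp
    · rw [Finset.sum_filter]
      exact Finset.sum_congr rfl fun e _ => by by_cases h : e ∈ B <;> simp [complWeight, h]
  by_cases h1 : ∃ e, 2 ≤ a e
  · obtain ⟨e, he⟩ := h1
    have heU : {e} ⊆ a.support := by simp; omega
    -- A smaller support would lie in a base, off which `a` has weight zero.
    have hU : k ≤ a.support.card := by
      by_contra! hlt
      obtain ⟨B, hUB, hB⟩ := hext _ (hsmall _ hlt)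
      have h := ha B hB
      rw [Finsupp.weight_apply, Finsupp.sum, Finset.sum_eq_zero] at h
      · omega
      · intro u hu
        simp [complWeight, hUB hu]
    -- Room for `e` in `I` needs `k ≥ 2`. The weight on `I`, hence on a base containing it, is at
    -- least `(k - 2) + 2 = k`.
    obtain ⟨I, heI, hIU, hI⟩ := Finset.exists_subsuperset_card_eq (n := k - 1) heU
      (by simp; omega) (by omega)
    obtain ⟨B, hIB, hB⟩ := hext I (hsmall I (by omega))
    have h2 : k ≤ ∑ e ∈ B, a e := by
      calc k = (I.erase e).card + 2 := by
            rw [Finset.card_erase_of_mem (by simpa using heI)]; omega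
        _ ≤ ∑ x ∈ I.erase e, a x + a e := by
            refine add_le_add ?_ he
            rw [Finset.card_eq_sum_ones]
            refine Finset.sum_le_sum fun x hx => Nat.one_le_iff_ne_zero.2 ?_
            exact Finsupp.mem_support_iff.1 (hIU (Finset.mem_of_mem_erase hx))
        _ = ∑ x ∈ I, a x := Finset.sum_erase_add _ _ (by simpa using heI)
        _ ≤ ∑ x ∈ B, a x := Finset.sum_le_sum_of_subset hIB
    have := hw B
    have := ha B hB
    have := genHammingWeight_le hk hr hrM
    omega
  · push Not at h1
    have h1 (x) (hx : x ∈ a.support) : a x = 1 := by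
      have := h1 x
      have := Finsupp.mem_support_iff.1 hx
      omega
    have hdeg : a.degree = a.support.card := by
      rw [Finsupp.degree_apply, Finset.card_eq_sum_ones]
      exact Finset.sum_congr rfl h1
    rw [hdeg]
    have := genHammingWeight_le_ncard hr (hsub a.support)
      (eRk_add_le_encard_of_forall_isBase (hsub _) fun B hB => ?_)
    · rwa [Set.ncard, henc, ENat.toNat_natCast] at this
    · obtain ⟨B, rfl⟩ : ∃ B' : Finset M.E, Subtype.val '' (B' : Set M.E) = B :=
        ⟨(Subtype.val ⁻¹' B : Set M.E).toFinset, by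
          rw [Set.coe_toFinset, Subtype.image_preimage_coe, Set.inter_eq_right.2 hB.subset_ground]⟩
      rw [← Set.image_sdiff Subtype.val_injective, ← Finset.coe_sdiff, henc]
      have h := ha B hB
      rw [Finsupp.weight_apply, Finsupp.sum] at h
      refine Nat.cast_le.2 (h.trans_eq ?_)
      rw [Finset.card_eq_sum_ones, Finset.sdiff_eq_filter, Finset.sum_filter]
      exact Finset.sum_congr rfl fun x hx => by
        by_cases hB : x ∈ B <;> simp [complWeight, hB, h1 x hx]

theorem mem_independenceComplex_iff (M : Matroid α) [M.Finite] (U : Finset M.E) :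
    U = ∅ ∨ U ∈ M.independenceComplex ↔
      ∃ B ∈ {B : Finset M.E | M.IsBase (Subtype.val '' (B : Set M.E))}, U ⊆ B := by
  have h : U = ∅ ∨ U ∈ M.independenceComplex ↔ M.Indep (Subtype.val '' (U : Set M.E)) := by
    rcases U.eq_empty_or_nonempty with rfl | hU
    · simp
    · simp only [hU.ne_empty, false_or]
      exact and_iff_right hU
  rw [h]
  constructor
  · intro hU
    have hfin : Fintype M.E := M.ground_finite.fintype
    classical
    obtain ⟨B, hB, hUB⟩ := hU.exists_isBase_superset
    refine ⟨(Subtype.val ⁻¹' B : Set M.E).toFinset, ?_, fun x hx => ?_⟩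
    · change M.IsBase _
      rwa [Set.coe_toFinset, Subtype.image_preimage_coe, Set.inter_eq_right.2 hB.subset_ground]
    · simpa using hUB ⟨x, by simpa using hx, rfl⟩
  · rintro ⟨B, hB, hUB⟩
    exact IsBase.indep hB |>.subset (Set.image_mono (by exact_mod_cast hUB))

theorem isAntichain_isBase (M : Matroid α) :
    IsAntichain (· ⊆ ·) {B : Finset M.E | M.IsBase (Subtype.val '' (B : Set M.E))} := by
  intro B hB B' hB' hne hsub
  have h := hB.eq_of_subset_isBase hB' (Set.image_mono (by exact_mod_cast hsub))
  exact hne (Finset.coe_injective (Subtype.val_injective.image_injective h))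

end Matroid

theorem mainTheorem9 {α : Type*} (M : Matroid α) [M.Finite] (L : Type*) [Field L]
    (n k : ℕ) (hn : M.E.ncard = n) (hk : M.eRank = (k : ℕ∞)) (hk2 : 2 ≤ k) (hkn : k + 1 ≤ n)
    (hM : M.IsPaving) :
    IsSubadditiveUpTo (fun r => (M.genHammingWeight r : ℝ)) (n - k) ∧
      ∀ r : ℕ, 1 ≤ r → r ≤ n - k →
        initialDegree (symbolicPower (stanleyReisnerIdeal L M.independenceComplex) r) =
          M.genHammingWeight r := by
  classical
  have hrM (r : ℕ) (hr : r ≤ n - k) : M.eRank + r ≤ M.E.encard := by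
    rw [hk, ← M.ground_finite.cast_ncard_eq, hn]
    exact_mod_cast (by omega : k + r ≤ n)
  refine ⟨fun i j hi hj hij => ?_, fun r hr hrn => ?_⟩
  -- `k + i + j ≤ (k + i - 1) + (k + j - 1)` because `k ≥ 2`.
  · have h1 := Matroid.genHammingWeight_le hk (by omega) (hrM (i + j) hij)
    have h2 := hM.le_genHammingWeight_add_one hk hi (hrM i (by omega))
    have h3 := hM.le_genHammingWeight_add_one hk hj (hrM j (by omega))
    beta_reduce
    exact_mod_cast (by omega :
      M.genHammingWeight (i + j) ≤ M.genHammingWeight i + M.genHammingWeight j)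
  · obtain ⟨C, hCE, hC, hcard⟩ := M.exists_ncard_eq_genHammingWeight hr (hrM r hrn)
    have hfin : Fintype M.E := M.ground_finite.fintype
    obtain ⟨U, rfl⟩ : ∃ U : Finset M.E, Subtype.val '' (U : Set M.E) = C :=
      ⟨(Subtype.val ⁻¹' C : Set M.E).toFinset, by
        rw [Set.coe_toFinset, Subtype.image_preimage_coe, Set.inter_eq_right.2 hCE]⟩
    rw [Set.ncard_image_of_injective _ Subtype.val_injective, Set.ncard_coe_finset] at hcard
    refine IsLeast.csInf_eq ⟨⟨∏ u ∈ U, MvPolynomial.X u, ?_, ?_, ?_⟩, ?_⟩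
    · refine prod_X_mem_symbolicPower M.mem_independenceComplex_iff M.isAntichain_isBase
        fun B hB => ?_
      have h := Matroid.IsBase.le_encard_sdiff hB hCE hC
      rw [← Set.image_sdiff Subtype.val_injective, Subtype.val_injective.encard_image,
        ← Finset.coe_sdiff, Set.encard_coe_eq_coe_finsetCard] at h
      exact_mod_cast h
    · exact Finset.prod_ne_zero_iff.2 fun u _ => MvPolynomial.X_ne_zero u
    · rw [← hcard, Finset.card_eq_sum_ones]
      exact MvPolynomial.IsHomogeneous.prod _ _ _ fun u _ => MvPolynomial.isHomogeneous_X L u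
    · rintro d ⟨f, hf, hf0, hd⟩
      obtain ⟨a, ha⟩ := MvPolynomial.support_nonempty.2 hf0
      have hdeg : a.degree = d := by
        rw [Finsupp.degree_eq_weight_one]
        exact hd (MvPolynomial.mem_support_iff.1 ha)
      rw [← hdeg]
      refine hM.genHammingWeight_le_degree hk hk2 hr (hrM r hrn) a fun B hB => ?_
      exact mem_weightIdeal.1 (symbolicPower_stanleyReisnerIdeal_le M.mem_independenceComplex_iff
        M.isAntichain_isBase hB r hf) a ha
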